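/- **Theorem.** An *i-lattice* is an algebra $(A,\wedge,\vee,\neg)$ such that $(A,\wedge,\vee)$ is a lattice, $\neg\neg a=a$, $\neg(a\vee b)=\neg a\wedge\neg b$ and $\neg(a\wedge b)=\neg a\vee\neg b$; it is *normal* if the lattice is distributive and $a\wedge\neg a\le b\vee\neg b$ for all $a,b$. Algebras are nonempty. Let $\underline{\mathbf L}$ be the i-lattice on $\{-1,0,1\}$ with $-1<0<1$ and $\neg x=-x$, and let $\underset{\sim}{\mathbf L}=(\{-1,0,1\},\le,Q,L_0,0,\tau)$, where $\le$ is the partial order whose only strict relations are $-1<0$ and $1<0$, $x\mathrel{Q}y$ iff $(x,y)\notin\{(-1,1),(1,-1)\}$, $L_0=\{-1,1\}$ is a unary relation, $0$ is a nullary constant, and $\tau$ is the discrete topology. Let $\mathcal A$ be the category of normal i-lattices and their homomorphisms. Let $\mathcal X$ be the category of isomorphic copies of topologically closed substructures of powers $\underset{\sim}{\mathbf L}^I$ ($I\ne\emptyset$), with continuous structure-preserving maps. For $\mathbf A\in\mathcal A$ and $\mathbf X\in\mathcal X$ let $D(\mathbf A)=\mathcal A(\mathbf A,\underline{\mathbf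 L})$, with structure inherited pointwise from $\underset{\sim}{\mathbf L}$, and $E(\mathbf X)=\mathcal X(\mathbf X,\underset{\sim}{\mathbf L})$, with operations inherited pointwise from $\underline{\mathbf L}$; on morphisms $D$ and $E$ act by precomposition. Let $e_{\mathbf A}\colon\mathbf A\to ED(\mathbf A)$, $e_{\mathbf A}(a)(x)=x(a)$, and $\varepsilon_{\mathbf X}\colon\mathbf X\to DE(\mathbf X)$, $\varepsilon_{\mathbf X}(x)(\alpha)=\alpha(x)$, be the evaluation maps. Then: 1. An i-lattice is normal if and only if it is isomorphic to a subalgebra of a power of $\underline{\mathbf L}$, i.e. the variety of normal i-lattices is $\mathbb{ISP}(\underline{\mathbf L})$. 2. $\underset{\sim}{\mathbf L}$ dualizes $\underline{\mathbf L}$: $e_{\mathbf A}$ is an isomorphism for every $\mathbf A\in\mathcal A$. 3. The duality is full: $\varepsilon_{\mathbf X}$ is an isomorphism in $\mathcal X$ for every $\mathbf X\in\mathcal X$. 4. The duality is strong. For every morphism $h$ of $\mathcal A$: $h$ is surjective iff $D(h)$ is an embedding, and $h$ is injective iff $D(h)$ is surjective. For every morphism $\varphi$ of $\mathcal X$: $\varphi$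 is an embedding iff $E(\varphi)$ is surjective, and $\varphi$ is surjective iff $E(\varphi)$ is injective. Here an embedding in $\mathcal X$ is an isomorphism onto a topologically closed substructure. -/

import Mathlib

open CategoryTheory

universe u v w

/-! ### Normal i-lattices -/

/-- A lattice with involution. -/
class ILattice (A : Type u) extends Lattice A, InvolutiveNeg A where
  neg_sup' : ∀ a b : A, -(a ⊔ b) = -a ⊓ -b
  neg_inf' : ∀ a b : A, -(a ⊓ b) = -a ⊔ -b

/-- An i-lattice is normal if it is distributive and satisfies `a ∧ ¬a ≤ b ∨ ¬b`. -/
class IsNormalILattice (A : Type u) [ILattice A] : Prop where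
  inf_sup_distrib : ∀ a b c : A, a ⊓ (b ⊔ c) = (a ⊓ b) ⊔ (a ⊓ c)
  inf_neg_le_sup_neg : ∀ a b : A, a ⊓ -a ≤ b ⊔ -b

/-- Homomorphisms of i-lattices. -/
structure ILatticeHom (A : Type u) (B : Type v) [ILattice A] [ILattice B]
    extends LatticeHom A B where
  map_neg' : ∀ a, toFun (-a) = -toFun a

namespace ILatticeHom

variable {A : Type u} {B : Type v} {C : Type w} [ILattice A] [ILattice B] [ILattice C]

instance : FunLike (ILatticeHom A B) A B where
  coe f := f.toFun
  coe_injective := by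
    rintro ⟨⟨⟨f, _⟩, _⟩, _⟩ ⟨⟨⟨g, _⟩, _⟩, _⟩ h
    cases h
    rfl

@[ext] theorem ext {f g : ILatticeHom A B} (h : ∀ a, f a = g a) : f = g := DFunLike.ext f g h

theorem map_sup (f : ILatticeHom A B) (a b : A) : f (a ⊔ b) = f a ⊔ f b := f.map_sup' a b
theorem map_inf (f : ILatticeHom A B) (a b : A) : f (a ⊓ b) = f a ⊓ f b := f.map_inf' a b
theorem map_neg (f : ILatticeHom A B) (a : A) : f (-a) = -f a := f.map_neg' a

/-- The identity homomorphism. -/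
def id (A : Type u) [ILattice A] : ILatticeHom A A where
  toFun a := a
  map_sup' _ _ := rfl
  map_inf' _ _ := rfl
  map_neg' _ := rfl

/-- Composition of homomorphisms. -/
def comp (g : ILatticeHom B C) (f : ILatticeHom A B) : ILatticeHom A C where
  toFun a := g (f a)
  map_sup' a b := by rw [f.map_sup, g.map_sup]
  map_inf' a b := by rw [f.map_inf, g.map_inf]
  map_neg' a := by rw [f.map_neg, g.map_neg]

end ILatticeHom

/-- The three-element i-lattice `{-1 < 0 < 1}`; Mathlib's `SignType`, with its usual linear order
and negation. -/
instance : ILattice SignType where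
  toLattice := inferInstance
  toInvolutiveNeg := inferInstance
  neg_sup' := by decide
  neg_inf' := by decide

/-- Powers of an i-lattice, with pointwise operations. -/
instance (I : Type u) (A : Type v) [ILattice A] : ILattice (I → A) where
  toLattice := inferInstance
  toInvolutiveNeg := inferInstance
  neg_sup' f g := funext fun i => ILattice.neg_sup' (f i) (g i)
  neg_inf' f g := funext fun i => ILattice.neg_inf' (f i) (g i)

/-- `A` is isomorphic to a subalgebra of a power of the three-element i-lattice. -/
def InISP (A : Type u) [ILattice A] : Prop :=
  ∃ (I : Type u) (f : ILatticeHom A (I → SignType)), Function.Injective f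

/-! ### Topological structures of the type of the alter ego -/

/-- The non-topological part of a structure `(X, ≤, Q, D, ⊤, τ)`: two binary relations, a unary
relation and a constant, with no axioms. -/
class KStruct (X : Type u) where
  le : X → X → Prop
  Q : X → X → Prop
  D : Set X
  pt : X

/-- The alter ego `({-1, 0, 1}, ≤, Q, {-1, 1}, 0)`: here `-1 < 0` and `1 < 0` generate `≤`, and
`x Q y` means `(x, y) ∉ {(-1, 1), (1, -1)}`. Its topology is Mathlib's discrete topology on
`SignType`. -/
instance : KStruct SignType where
  le x y := x = y ∨ y = 0
  Q x y := ¬ (x = -1 ∧ y = 1) ∧ ¬ (x = 1 ∧ y = -1)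
  D := {-1, 1}
  pt := 0

/-- Powers of a structure, with pointwise relations and constant (and the product topology). -/
instance (I : Type u) (X : Type v) [KStruct X] : KStruct (I → X) where
  le f g := ∀ i, KStruct.le (f i) (g i)
  Q f g := ∀ i, KStruct.Q (f i) (g i)
  D := {f | ∀ i, f i ∈ KStruct.D}
  pt := fun _ => KStruct.pt

/-- `f` is an isomorphism of `X` onto a topologically closed substructure of `Y`. -/
structure IsKEmbedding {X : Type u} {Y : Type v} [TopologicalSpace X] [KStruct X]
    [TopologicalSpace Y] [KStruct Y] (f : X → Y) : Prop where
  isClosedEmbedding : Topology.IsClosedEmbedding f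
  le_iff : ∀ x y, KStruct.le (f x) (f y) ↔ KStruct.le x y
  Q_iff : ∀ x y, KStruct.Q (f x) (f y) ↔ KStruct.Q x y
  D_iff : ∀ x, f x ∈ KStruct.D ↔ x ∈ KStruct.D
  map_pt : f KStruct.pt = KStruct.pt

/-- `X` is an isomorphic copy of a closed substructure of a power, with nonempty index set, of the
alter ego. -/
def InIScP (X : Type u) [TopologicalSpace X] [KStruct X] : Prop :=
  ∃ (I : Type u) (f : X → I → SignType), Nonempty I ∧ IsKEmbedding f

/-- Continuous structure-preserving maps. -/
structure KHom (X : Type u) (Y : Type v) [TopologicalSpace X] [KStruct X]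
    [TopologicalSpace Y] [KStruct Y] where
  toFun : X → Y
  continuous' : Continuous toFun
  map_le' : ∀ x y, KStruct.le x y → KStruct.le (toFun x) (toFun y)
  map_Q' : ∀ x y, KStruct.Q x y → KStruct.Q (toFun x) (toFun y)
  map_D' : ∀ x ∈ KStruct.D, toFun x ∈ KStruct.D
  map_pt' : toFun KStruct.pt = KStruct.pt

namespace KHom

variable {X : Type u} {Y : Type v} {Z : Type w} [TopologicalSpace X] [KStruct X]
  [TopologicalSpace Y] [KStruct Y] [TopologicalSpace Z] [KStruct Z]

instance : FunLike (KHom X Y) X Y where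
  coe f := f.toFun
  coe_injective f g h := by cases f; cases g; congr

@[ext] theorem ext {f g : KHom X Y} (h : ∀ x, f x = g x) : f = g := DFunLike.ext f g h

/-- The identity morphism. -/
def id (X : Type u) [TopologicalSpace X] [KStruct X] : KHom X X where
  toFun x := x
  continuous' := continuous_id
  map_le' _ _ h := h
  map_Q' _ _ h := h
  map_D' _ h := h
  map_pt' := rfl

/-- Composition of morphisms. -/
def comp (g : KHom Y Z) (f : KHom X Y) : KHom X Z where
  toFun x := g (f x)
  continuous' := g.continuous'.comp f.continuous'
  map_le' _ _ h := g.map_le' _ _ (f.map_le' _ _ h)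
  map_Q' _ _ h := g.map_Q' _ _ (f.map_Q' _ _ h)
  map_D' _ h := g.map_D' _ (f.map_D' _ h)
  map_pt' := (congrArg g f.map_pt').trans g.map_pt'

end KHom

/-! ### The hom-sets into `{-1, 0, 1}` -/

/-- The structure of `D(A)`, inherited pointwise from the alter ego. -/
instance (A : Type u) [ILattice A] : KStruct (ILatticeHom A SignType) where
  le x y := ∀ a, KStruct.le (x a) (y a)
  Q x y := ∀ a, KStruct.Q (x a) (y a)
  D := {x | ∀ a, x a ∈ KStruct.D}
  pt :=
    { toFun := fun _ => 0
      map_sup' := fun _ _ => rfl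
      map_inf' := fun _ _ => rfl
      map_neg' := fun _ => rfl }

/-- The topology of `D(A)`, inherited from the product topology on `{-1, 0, 1} ^ A`. -/
instance (A : Type u) [ILattice A] : TopologicalSpace (ILatticeHom A SignType) :=
  TopologicalSpace.induced (fun (x : ILatticeHom A SignType) (a : A) => x a) inferInstance

theorem inIScP_hom (A : Type u) [ILattice A] [Nonempty A] :
    InIScP (ILatticeHom A SignType) := by
  refine ⟨A, fun x a => x a, inferInstance, ⟨⟨⟨⟨rfl⟩, DFunLike.coe_injective⟩, ?_⟩,
    fun _ _ => Iff.rfl, fun _ _ => Iff.rfl, fun _ => Iff.rfl, rfl⟩⟩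
  have : Set.range (fun (x : ILatticeHom A SignType) (a : A) => x a) =
      {f : A → SignType | (∀ a b, f (a ⊔ b) = f a ⊔ f b) ∧ (∀ a b, f (a ⊓ b) = f a ⊓ f b) ∧
        ∀ a, f (-a) = -f a} := by
    ext f
    constructor
    · rintro ⟨x, rfl⟩
      exact ⟨x.map_sup, x.map_inf, x.map_neg⟩
    · rintro ⟨h1, h2, h3⟩
      exact ⟨⟨⟨⟨f, h1⟩, h2⟩, h3⟩, rfl⟩
  rw [this]
  have c2 : ∀ g : SignType → SignType → SignType, Continuous fun p : SignType × SignType =>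
      g p.1 p.2 := fun _ => continuous_of_discreteTopology
  have c1 : ∀ g : SignType → SignType, Continuous g := fun _ => continuous_of_discreteTopology
  simp only [Set.ofPred_and, Set.ofPred_forall]
  refine IsClosed.inter ?_ (IsClosed.inter ?_ ?_)
  · refine isClosed_iInter fun a => isClosed_iInter fun b => isClosed_eq (continuous_apply _) ?_
    exact (c2 (· ⊔ ·)).comp (g := fun p : SignType × SignType => p.1 ⊔ p.2)
      (f := fun f : A → SignType => (f a, f b)) ((continuous_apply a).prodMk (continuous_apply b))
  · refine isClosed_iInter fun a => isClosed_iInter fun b => isClosed_eq (continuous_apply _) ?_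
    exact (c2 (· ⊓ ·)).comp (g := fun p : SignType × SignType => p.1 ⊓ p.2)
      (f := fun f : A → SignType => (f a, f b)) ((continuous_apply a).prodMk (continuous_apply b))
  · refine isClosed_iInter fun a => isClosed_eq (continuous_apply _) ?_
    exact (c1 (- ·)).comp (continuous_apply a)

section Algebraic

/-! The relations and the constant of the alter ego are subalgebras of powers of the i-lattice. -/

instance : DecidableRel (KStruct.le : SignType → SignType → Prop) := fun x y =>
  inferInstanceAs (Decidable (x = y ∨ y = 0))

instance : DecidableRel (KStruct.Q : SignType → SignType → Prop) := fun x y =>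
  inferInstanceAs (Decidable (¬ (x = -1 ∧ y = 1) ∧ ¬ (x = 1 ∧ y = -1)))

instance : DecidablePred (· ∈ (KStruct.D : Set SignType)) := fun x =>
  inferInstanceAs (Decidable (x = -1 ∨ x = 1))

theorem SignType.kle_sup : ∀ a b c d : SignType, KStruct.le a c → KStruct.le b d →
    KStruct.le (a ⊔ b) (c ⊔ d) := by decide
theorem SignType.kle_inf : ∀ a b c d : SignType, KStruct.le a c → KStruct.le b d →
    KStruct.le (a ⊓ b) (c ⊓ d) := by decide
theorem SignType.kle_neg : ∀ a b : SignType, KStruct.le a b → KStruct.le (-a) (-b) := by decide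
theorem SignType.kQ_sup : ∀ a b c d : SignType, KStruct.Q a c → KStruct.Q b d →
    KStruct.Q (a ⊔ b) (c ⊔ d) := by decide
theorem SignType.kQ_inf : ∀ a b c d : SignType, KStruct.Q a c → KStruct.Q b d →
    KStruct.Q (a ⊓ b) (c ⊓ d) := by decide
theorem SignType.kQ_neg : ∀ a b : SignType, KStruct.Q a b → KStruct.Q (-a) (-b) := by decide
theorem SignType.kD_sup : ∀ a b : SignType, a ∈ KStruct.D → b ∈ KStruct.D →
    a ⊔ b ∈ KStruct.D := by decide
theorem SignType.kD_inf : ∀ a b : SignType, a ∈ KStruct.D → b ∈ KStruct.D →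
    a ⊓ b ∈ KStruct.D := by decide
theorem SignType.kD_neg : ∀ a : SignType, a ∈ KStruct.D → -a ∈ KStruct.D := by decide

end Algebraic

section HomAlgebra

variable {X : Type u} [TopologicalSpace X] [KStruct X]

instance : Max (KHom X SignType) where
  max f g :=
    { toFun := fun x => f x ⊔ g x
      continuous' := (continuous_of_discreteTopology
        (f := fun p : SignType × SignType => p.1 ⊔ p.2)).comp (f.continuous'.prodMk g.continuous')
      map_le' := fun _ _ h => SignType.kle_sup _ _ _ _ (f.map_le' _ _ h) (g.map_le' _ _ h)
      map_Q' := fun _ _ h => SignType.kQ_sup _ _ _ _ (f.map_Q' _ _ h) (g.map_Q' _ _ h)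
      map_D' := fun _ h => SignType.kD_sup _ _ (f.map_D' _ h) (g.map_D' _ h)
      map_pt' := congrArg₂ (· ⊔ ·) f.map_pt' g.map_pt' }

instance : Min (KHom X SignType) where
  min f g :=
    { toFun := fun x => f x ⊓ g x
      continuous' := (continuous_of_discreteTopology
        (f := fun p : SignType × SignType => p.1 ⊓ p.2)).comp (f.continuous'.prodMk g.continuous')
      map_le' := fun _ _ h => SignType.kle_inf _ _ _ _ (f.map_le' _ _ h) (g.map_le' _ _ h)
      map_Q' := fun _ _ h => SignType.kQ_inf _ _ _ _ (f.map_Q' _ _ h) (g.map_Q' _ _ h)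
      map_D' := fun _ h => SignType.kD_inf _ _ (f.map_D' _ h) (g.map_D' _ h)
      map_pt' := congrArg₂ (· ⊓ ·) f.map_pt' g.map_pt' }

instance : Neg (KHom X SignType) where
  neg f :=
    { toFun := fun x => -f x
      continuous' := (continuous_of_discreteTopology
        (f := fun p : SignType => -p)).comp f.continuous'
      map_le' := fun _ _ h => SignType.kle_neg _ _ (f.map_le' _ _ h)
      map_Q' := fun _ _ h => SignType.kQ_neg _ _ (f.map_Q' _ _ h)
      map_D' := fun _ h => SignType.kD_neg _ (f.map_D' _ h)
      map_pt' := congrArg (- ·) f.map_pt' }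

/-- The i-lattice `E(X)`, with operations and order inherited pointwise from `{-1 < 0 < 1}`. -/
instance : ILattice (KHom X SignType) where
  le f g := ∀ x, f x ≤ g x
  le_refl _ _ := le_rfl
  le_trans _ _ _ h h' x := (h x).trans (h' x)
  le_antisymm _ _ h h' := KHom.ext fun x => le_antisymm (h x) (h' x)
  sup f g := f ⊔ g
  inf f g := f ⊓ g
  le_sup_left f g x := le_sup_left (a := f x) (b := g x)
  le_sup_right f g x := le_sup_right (a := f x) (b := g x)
  sup_le _ _ _ h h' x := sup_le (h x) (h' x)
  inf_le_left f g x := inf_le_left (a := f x) (b := g x)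
  inf_le_right f g x := inf_le_right (a := f x) (b := g x)
  le_inf _ _ _ h h' x := le_inf (h x) (h' x)
  neg_neg f := KHom.ext fun x => neg_neg (f x)
  neg_sup' f g := KHom.ext fun x => ILattice.neg_sup' (f x) (g x)
  neg_inf' f g := KHom.ext fun x => ILattice.neg_inf' (f x) (g x)

instance : IsNormalILattice (KHom X SignType) where
  inf_sup_distrib f g h := KHom.ext fun x => inf_sup_left (f x) (g x) (h x)
  inf_neg_le_sup_neg f g x :=
    (by decide : ∀ a b : SignType, a ⊓ -a ≤ b ⊔ -b) (f x) (g x)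

theorem nonempty_kHom (hX : InIScP X) : Nonempty (KHom X SignType) := by
  obtain ⟨I, f, ⟨i⟩, hf⟩ := hX
  exact ⟨{
    toFun := fun x => f x i
    continuous' := (continuous_apply i).comp hf.isClosedEmbedding.continuous
    map_le' := fun x y h => (hf.le_iff x y).2 h i
    map_Q' := fun x y h => (hf.Q_iff x y).2 h i
    map_D' := fun x h => (hf.D_iff x).2 h i
    map_pt' := congrFun hf.map_pt i }⟩

end HomAlgebra

/-! ### The two categories and the dual adjunction -/

/-- Objects of the category of normal i-lattices (algebras are nonempty). -/
structure NormalILat : Type (u + 1) where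
  carrier : Type u
  [ilattice : ILattice carrier]
  [normal : IsNormalILattice carrier]
  [nonempty : Nonempty carrier]

namespace NormalILat

instance : CoeSort NormalILat.{u} (Type u) := ⟨carrier⟩

attribute [instance] ilattice normal nonempty

instance : Category NormalILat.{u} where
  Hom A B := ILatticeHom A B
  id A := ILatticeHom.id A
  comp f g := ILatticeHom.comp g f

/-- The map underlying a morphism. -/
def toMap {A B : NormalILat.{u}} (h : A ⟶ B) : A → B := ILatticeHom.instFunLike.coe h

end NormalILat

/-- Objects of the category of isomorphic copies of closed substructures of nonempty powers of the
alter ego. -/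
structure PKleeneSp : Type (u + 1) where
  carrier : Type u
  [top : TopologicalSpace carrier]
  [str : KStruct carrier]
  mem : InIScP carrier

namespace PKleeneSp

instance : CoeSort PKleeneSp.{u} (Type u) := ⟨carrier⟩

attribute [instance] top str

instance : Category PKleeneSp.{u} where
  Hom X Y := KHom X Y
  id X := KHom.id X
  comp f g := KHom.comp g f

/-- The map underlying a morphism. -/
def toMap {X Y : PKleeneSp.{u}} (φ : X ⟶ Y) : X → Y := KHom.instFunLike.coe φ

end PKleeneSp

/-- The functor `D = Hom(-, {-1 < 0 < 1})`, acting on morphisms by precomposition. -/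
def dualD : NormalILat.{u}ᵒᵖ ⥤ PKleeneSp.{u} where
  obj A := ⟨ILatticeHom A.unop SignType, inIScP_hom A.unop⟩
  map h :=
    { toFun := fun x => ILatticeHom.comp x h.unop
      continuous' := continuous_induced_rng.2 <| continuous_pi fun b =>
        (continuous_apply (NormalILat.toMap h.unop b)).comp continuous_induced_dom
      map_le' := fun _ _ hx b => hx (NormalILat.toMap h.unop b)
      map_Q' := fun _ _ hx b => hx (NormalILat.toMap h.unop b)
      map_D' := fun _ hx b => hx (NormalILat.toMap h.unop b)
      map_pt' := rfl }
  map_id _ := rfl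
  map_comp _ _ := rfl

/-- The functor `E = Hom(-, alter ego)`, acting on morphisms by precomposition. -/
def dualE : PKleeneSp.{u}ᵒᵖ ⥤ NormalILat.{u} where
  obj X :=
    { carrier := KHom X.unop SignType
      nonempty := nonempty_kHom X.unop.mem }
  map φ :=
    { toFun := fun α => KHom.comp α φ.unop
      map_sup' := fun _ _ => rfl
      map_inf' := fun _ _ => rfl
      map_neg' := fun _ => rfl }
  map_id _ := rfl
  map_comp _ _ := rfl

/-- The evaluation `e_A : A → ED(A)`, `e_A(a)(x) = x(a)`. -/
def evalE : 𝟭 NormalILat.{u} ⟶ dualD.rightOp ⋙ dualE where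
  app A :=
    { toFun := fun a =>
        { toFun := fun x : ILatticeHom A SignType => x a
          continuous' := (continuous_apply a).comp continuous_induced_dom
          map_le' := fun _ _ h => h a
          map_Q' := fun _ _ h => h a
          map_D' := fun _ h => h a
          map_pt' := rfl }
      map_sup' := fun a b => KHom.ext fun x : ILatticeHom A SignType => x.map_sup a b
      map_inf' := fun a b => KHom.ext fun x : ILatticeHom A SignType => x.map_inf a b
      map_neg' := fun a => KHom.ext fun x : ILatticeHom A SignType => x.map_neg a }
  naturality _ _ _ := rfl

/-- The evaluation `ε_X : X → DE(X)`, `ε_X(x)(α) = α(x)`. -/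
def evalD : 𝟭 PKleeneSp.{u} ⟶ dualE.rightOp ⋙ dualD where
  app X :=
    { toFun := fun x =>
        { toFun := fun α : KHom X SignType => α x
          map_sup' := fun _ _ => rfl
          map_inf' := fun _ _ => rfl
          map_neg' := fun _ => rfl }
      continuous' := continuous_induced_rng.2 <| continuous_pi fun α : KHom X SignType =>
        α.continuous'
      map_le' := fun _ _ h (α : KHom X SignType) => α.map_le' _ _ h
      map_Q' := fun _ _ h (α : KHom X SignType) => α.map_Q' _ _ h
      map_D' := fun _ h (α : KHom X SignType) => α.map_D' _ h
      map_pt' := ILatticeHom.ext fun α : KHom X SignType => α.map_pt' }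
  naturality _ _ _ := rfl

/-- The dual adjunction `(D, E, e, ε)`, as an ordinary adjunction with the opposite category. -/
def dualAdjunction : dualE.{u}.rightOp ⊣ dualD.{u} where
  unit := evalD
  counit := { app := fun A => (evalE.app A.unop).op, naturality := fun _ _ _ => rfl }
  left_triangle_components _ := rfl
  right_triangle_components _ := rfl

/-! ### Separation of points by homomorphisms -/

/-! The algebraic source is separation. A prime filter containing no pair `x`, `-x` gives a
homomorphism to the three-element algebra, and normality guarantees that any prime filter, or else
its dual under negation, has this property. Hence `a ≰ b` is always witnessed by a homomorphism,
which gives the description as a prevariety and the injectivity of `e_A`.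

Two representation arguments carry the rest. First, `IsKEmbedding.exists_eval_eq`: the constraints
imposed by `≤`, `Q`, `{-1, 1}` and `0` are exactly what is needed to realize prescribed values at
two points, and a Stone–Weierstrass argument by finite joins and meets over a compact structure
passes from two points to all of them. Second, `KHom.surjective_of_separates`: a compact family of
evaluations that separates elements already contains every homomorphism, because a homomorphism is
determined by the preimage of `1`, and this preimage can be matched by the finite intersection
property.

Surjectivity of `e_A` is the first result for the identity of `D(A)`; surjectivity of `ε_X` is the
second, as elements of `E(X)` are separated by points of `X`. Strongness follows by applying both to
`D(h)` and to `ε`, with naturality of `ε` for the converses on the topological side. -/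

namespace ILattice

variable {A : Type u} [ILattice A]

/-- A prime filter that contains no pair `a`, `-a` determines a homomorphism to the three-element
i-lattice. -/
theorem exists_hom_of_prime (P : A → Prop) (hsup : ∀ a b, P (a ⊔ b) ↔ P a ∨ P b)
    (hinf : ∀ a b, P (a ⊓ b) ↔ P a ∧ P b) (hneg : ∀ a, P a → ¬ P (-a)) :
    ∃ f : ILatticeHom A SignType, (∀ a, f a = 1 ↔ P a) ∧ ∀ a, f a = -1 ↔ P (-a) := by
  classical
  refine ⟨⟨⟨⟨fun a => if P a then 1 else if P (-a) then -1 else 0, fun a b => ?_⟩,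
    fun a b => ?_⟩, fun a => ?_⟩, fun a => ?_, fun a => ?_⟩
  · have ha := hneg a
    have hb := hneg b
    simp only [neg_sup', hsup, hinf]
    by_cases h1 : P a <;> by_cases h2 : P b <;> by_cases h3 : P (-a) <;>
      by_cases h4 : P (-b) <;> simp_all
  · have ha := hneg a
    have hb := hneg b
    simp only [neg_inf', hsup, hinf]
    by_cases h1 : P a <;> by_cases h2 : P b <;> by_cases h3 : P (-a) <;>
      by_cases h4 : P (-b) <;> simp_all
  · have ha := hneg a
    simp only [neg_neg]
    by_cases h1 : P a <;> by_cases h3 : P (-a) <;> simp_all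
  · change (if P a then (1 : SignType) else if P (-a) then -1 else 0) = 1 ↔ _
    by_cases h1 : P a <;> by_cases h3 : P (-a) <;> simp_all
  · change (if P a then (1 : SignType) else if P (-a) then -1 else 0) = -1 ↔ _
    have ha := hneg a
    by_cases h1 : P a <;> by_cases h3 : P (-a) <;> simp_all

variable [IsNormalILattice A]

/-- Elements of a normal i-lattice with `a ≰ b` are separated by a prime filter. -/
theorem exists_prime_of_not_le {a b : A} (hab : ¬ a ≤ b) :
    ∃ P : A → Prop, (∀ a b, P (a ⊔ b) ↔ P a ∨ P b) ∧ (∀ a b, P (a ⊓ b) ↔ P a ∧ P b) ∧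
      P a ∧ ¬ P b := by
  let _ : DistribLattice A := DistribLattice.ofInfSupLe fun x y z =>
    (IsNormalILattice.inf_sup_distrib x y z).le
  obtain ⟨J, hJ, hIJ, hFJ⟩ := DistribLattice.prime_ideal_of_disjoint_filter_ideal
    (F := Order.PFilter.principal a) (I := Order.Ideal.principal b)
    (Set.disjoint_left.2 fun x hx hx' => hab (le_trans hx hx'))
  refine ⟨fun x => x ∉ J, fun x y => ?_, fun x y => ?_, ?_, ?_⟩
  · beta_reduce
    rw [Order.Ideal.sup_mem_iff, not_and_or]
  · beta_reduce
    rw [← not_or, not_iff_not]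
    exact ⟨hJ.mem_or_mem, fun h => h.elim (J.lower inf_le_left) (J.lower inf_le_right)⟩
  · exact Set.disjoint_left.1 hFJ (le_refl a)
  · exact not_not.2 (hIJ (le_refl b))

/-- Homomorphisms to the three-element i-lattice separate the points of a normal i-lattice. -/
theorem exists_hom_not_le {a b : A} (hab : ¬ a ≤ b) :
    ∃ f : ILatticeHom A SignType, ¬ f a ≤ f b := by
  obtain ⟨P, hsup, hinf, ha, hb⟩ := exists_prime_of_not_le hab
  have hmono : ∀ x y, x ≤ y → P x → P y := fun x y h hx => by
    rw [← sup_eq_right.2 h, hsup]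
    exact Or.inl hx
  by_cases h : ∀ x, P x → ¬ P (-x)
  · obtain ⟨f, hf, -⟩ := exists_hom_of_prime P hsup hinf h
    refine ⟨f, fun hle => hb ((hf b).1 ?_)⟩
    rw [(hf a).2 ha] at hle
    exact le_antisymm (by cases f b <;> decide) hle
  · push Not at h
    obtain ⟨x, hx, hx'⟩ := h
    -- As `x ⊓ -x` lies in `P`, normality puts every `y ⊔ -y` in `P`, so `y` or `-y` lies in `P`.
    -- Thus the dual prime filter contains no complementary pair. Its homomorphism sends `b`, but
    -- not `a`, to `-1`.
    obtain ⟨f, -, hf⟩ := exists_hom_of_prime (fun y => ¬ P (-y))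
      (fun y z => by rw [neg_sup', hinf, not_and_or])
      (fun y z => by rw [neg_inf', hsup, not_or])
      (fun y hy hy' => by
        have := hmono _ _ (IsNormalILattice.inf_neg_le_sup_neg x y) ((hinf _ _).2 ⟨hx, hx'⟩)
        rw [neg_neg] at hy'
        exact ((hsup _ _).1 this).elim hy' hy)
    simp only [neg_neg] at hf
    refine ⟨f, fun hle => (hf a).not.2 (not_not.2 ha) ?_⟩
    rw [(hf b).2 hb] at hle
    exact le_antisymm hle (by cases f a <;> decide)

theorem le_of_forall_hom_le {a b : A} (h : ∀ f : ILatticeHom A SignType, f a ≤ f b) : a ≤ b := by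
  by_contra hab
  obtain ⟨f, hf⟩ := exists_hom_not_le hab
  exact hf (h f)

theorem eq_of_forall_hom_eq {a b : A} (h : ∀ f : ILatticeHom A SignType, f a = f b) : a = b :=
  le_antisymm (le_of_forall_hom_le fun f => (h f).le) (le_of_forall_hom_le fun f => (h f).ge)

end ILattice

/-- The normal i-lattices are the isomorphic copies of subalgebras of powers of the three-element
i-lattice. -/
theorem isNormalILattice_iff_inISP (A : Type u) [ILattice A] :
    IsNormalILattice A ↔ InISP A := by
  constructor
  · intro _
    exact ⟨ILatticeHom A SignType, ⟨⟨⟨fun a f => f a, fun a b => funext fun f => f.map_sup a b⟩,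
      fun a b => funext fun f => f.map_inf a b⟩, fun a => funext fun f => f.map_neg a⟩,
      fun a b h => ILattice.eq_of_forall_hom_eq (congrFun h)⟩
  · rintro ⟨I, f, hf⟩
    refine ⟨fun a b c => hf ?_, fun a b => ?_⟩
    · simp only [f.map_inf, f.map_sup]
      exact funext fun i => inf_sup_left _ _ _
    · rw [← sup_eq_right]
      apply hf
      simp only [f.map_inf, f.map_sup, f.map_neg]
      exact funext fun i => (by decide : ∀ x y : SignType, (x ⊓ -x) ⊔ (y ⊔ -y) = y ⊔ -y) _ _

/-! ### Interpolation -/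

section Interpolation

variable {B : Type v} [ILattice B]

/-- The range of `f` is closed under negation: omitting `0` forces `f` into the unary relation, and
attaining no nonzero value makes `f` the constant. -/
theorem exists_hom_apply_eq [Nonempty B] (f : ILatticeHom B SignType) (p : SignType)
    (h0 : f = KStruct.pt → p = 0) (hD : f ∈ KStruct.D → p ∈ KStruct.D) : ∃ b, f b = p := by
  by_cases hp : p = 0
  · by_contra! h
    subst hp
    refine (by decide : (0 : SignType) ∉ KStruct.D) (hD fun b => ?_)
    exact (by decide : ∀ x : SignType, x ≠ 0 → x ∈ KStruct.D) _ (h b)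
  · have : ∃ b, f b ≠ 0 := by
      by_contra! h
      exact hp (h0 (ILatticeHom.ext h))
    obtain ⟨b, hb⟩ := this
    rcases (by decide : ∀ x y : SignType, x ≠ 0 → y ≠ 0 → x = y ∨ -x = y) _ _ hb hp with h | h
    · exact ⟨b, h⟩
    · exact ⟨-b, (f.map_neg b).trans h⟩

/-- The case of `exists_hom_apply_eq_and_eq` where the second value is `0`. -/
theorem exists_hom_apply_eq_and_eq_zero (f g : ILatticeHom B SignType) (p : SignType)
    (hf : ∃ b, f b = p) (hg : ∃ b, g b = 0) (hle : KStruct.le g f → KStruct.le 0 p) :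
    ∃ b, f b = p ∧ g b = 0 := by
  obtain ⟨b, hb⟩ := hg
  by_cases hp : p = 0
  · obtain ⟨a, ha⟩ := hf
    subst hp
    -- Each `x ⊓ -x` takes values at most `0`, and at each of `f`, `g` one of the two terms equals
    -- `0`.
    refine ⟨(a ⊓ -a) ⊔ (b ⊓ -b), ?_⟩
    simp only [ILatticeHom.map_sup, ILatticeHom.map_inf, ILatticeHom.map_neg, ha, hb]
    exact (by decide : ∀ x y : SignType, (0 ⊓ -0) ⊔ (x ⊓ -x) = 0 ∧
      (y ⊓ -y) ⊔ (0 ⊓ -0) = 0) _ _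
  · have : ∃ c, ¬ KStruct.le (g c) (f c) := by
      by_contra! h
      exact (by decide : ∀ x : SignType, x ≠ 0 → ¬ KStruct.le 0 x) p hp (hle h)
    obtain ⟨c, hc⟩ := this
    -- Failure of `≤` at `c` means `f c ≠ 0` and `g c ≠ f c`. Up to sign `f c = 1` and `g c ≤ 0`;
    -- joining with `b ⊓ -b`, which is `0` under `g` and at most `0` under `f`, yields the pair `(1,
    -- 0)`. A final negation adjusts the sign.
    have key : ∀ x y z q : SignType, q ≠ 0 → ¬ KStruct.le y x →
        (x ⊔ (z ⊓ -z) = q ∧ y ⊔ (0 ⊓ -0) = 0) ∨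
        (-x ⊔ (z ⊓ -z) = q ∧ -y ⊔ (0 ⊓ -0) = 0) ∨
        (-(x ⊔ (z ⊓ -z)) = q ∧ -(y ⊔ (0 ⊓ -0)) = 0) ∨
        (-(-x ⊔ (z ⊓ -z)) = q ∧ -(-y ⊔ (0 ⊓ -0)) = 0) := by decide
    rcases key _ _ (f b) p hp hc with h | h | h | h
    · exact ⟨c ⊔ (b ⊓ -b), by
        simpa only [ILatticeHom.map_sup, ILatticeHom.map_inf, ILatticeHom.map_neg, hb] using h⟩
    · exact ⟨-c ⊔ (b ⊓ -b), by
        simpa only [ILatticeHom.map_sup, ILatticeHom.map_inf, ILatticeHom.map_neg, hb] using h⟩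
    · exact ⟨-(c ⊔ (b ⊓ -b)), by
        simpa only [ILatticeHom.map_sup, ILatticeHom.map_inf, ILatticeHom.map_neg, hb] using h⟩
    · exact ⟨-(-c ⊔ (b ⊓ -b)), by
        simpa only [ILatticeHom.map_sup, ILatticeHom.map_inf, ILatticeHom.map_neg, hb] using h⟩

/-- Two-point interpolation: the binary relations of the alter ego determine which pairs of values
are attained by a pair of homomorphisms. -/
theorem exists_hom_apply_eq_and_eq [Nonempty B] (f g : ILatticeHom B SignType) (p q : SignType)
    (hf0 : f = KStruct.pt → p = 0) (hg0 : g = KStruct.pt → q = 0)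
    (hfD : f ∈ KStruct.D → p ∈ KStruct.D) (hgD : g ∈ KStruct.D → q ∈ KStruct.D)
    (hfg : KStruct.le f g → KStruct.le p q) (hgf : KStruct.le g f → KStruct.le q p)
    (hQ : KStruct.Q f g → KStruct.Q p q) : ∃ b, f b = p ∧ g b = q := by
  obtain ⟨a, ha⟩ := exists_hom_apply_eq f p hf0 hfD
  obtain ⟨b, hb⟩ := exists_hom_apply_eq g q hg0 hgD
  by_cases hq : q = 0
  · subst hq
    exact exists_hom_apply_eq_and_eq_zero f g p ⟨a, ha⟩ ⟨b, hb⟩ hgf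
  by_cases hp : p = 0
  · subst hp
    obtain ⟨c, hc, hc'⟩ := exists_hom_apply_eq_and_eq_zero g f q ⟨b, hb⟩ ⟨a, ha⟩ hfg
    exact ⟨c, hc', hc⟩
  by_cases hpq : p = q
  · subst hpq
    rcases (by decide : ∀ x : SignType, x ≠ 0 → x = 1 ∨ x = -1) p hp with rfl | rfl
    · refine ⟨a ⊔ b, ?_⟩
      simp only [ILatticeHom.map_sup, ha, hb]
      exact (by decide : ∀ x y : SignType, 1 ⊔ x = 1 ∧ y ⊔ 1 = 1) _ _
    · refine ⟨a ⊓ b, ?_⟩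
      simp only [ILatticeHom.map_inf, ha, hb]
      exact (by decide : ∀ x y : SignType, -1 ⊓ x = -1 ∧ y ⊓ -1 = -1) _ _
  -- The values are now opposite and nonzero, a pair excluded by `Q`; any failure of `Q` is this
  -- pair up to sign.
  · have : ∃ c, ¬ KStruct.Q (f c) (g c) := by
      by_contra! h
      exact (by decide : ∀ x y : SignType, x ≠ 0 → y ≠ 0 → x ≠ y → ¬ KStruct.Q x y) p q hp hq hpq
        (hQ h)
    obtain ⟨c, hc⟩ := this
    rcases (by decide : ∀ x y p q : SignType, p ≠ 0 → q ≠ 0 → p ≠ q → ¬ KStruct.Q x y →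
      (x = p ∧ y = q) ∨ (-x = p ∧ -y = q)) _ _ p q hp hq hpq hc with h | h
    · exact ⟨c, h⟩
    · exact ⟨-c, by simpa only [ILatticeHom.map_neg] using h⟩

end Interpolation

/-! ### Compactness and embeddings -/

section Topology

variable {X : Type u} [TopologicalSpace X] [KStruct X]

theorem InIScP.compactSpace (hX : InIScP X) : CompactSpace X := by
  obtain ⟨I, f, -, hf⟩ := hX
  exact hf.isClosedEmbedding.compactSpace

theorem InIScP.t2Space (hX : InIScP X) : T2Space X := by
  obtain ⟨I, f, -, hf⟩ := hX
  exact hf.isClosedEmbedding.isEmbedding.t2Space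

theorem continuous_hom_apply {B : Type v} [ILattice B] (b : B) :
    Continuous fun f : ILatticeHom B SignType => f b :=
  (continuous_apply b).comp continuous_induced_dom

/-- The evaluation map `X → DE(X)`. -/
def evalHom (X : Type u) [TopologicalSpace X] [KStruct X] :
    KHom X (ILatticeHom (KHom X SignType) SignType) where
  toFun x :=
    { toFun := fun α : KHom X SignType => α x
      map_sup' := fun _ _ => rfl
      map_inf' := fun _ _ => rfl
      map_neg' := fun _ => rfl }
  continuous' := continuous_induced_rng.2 <| continuous_pi fun α : KHom X SignType => α.continuous'
  map_le' _ _ h := fun α : KHom X SignType => α.map_le' _ _ h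
  map_Q' _ _ h := fun α : KHom X SignType => α.map_Q' _ _ h
  map_D' _ h := fun α : KHom X SignType => α.map_D' _ h
  map_pt' := ILatticeHom.ext fun α : KHom X SignType => α.map_pt'

/-- The coordinates of an embedding into a power are themselves morphisms to the alter ego, so
evaluations reflect equality and all relations; compactness makes the image closed. -/
theorem isKEmbedding_evalHom (hX : InIScP X) : IsKEmbedding (evalHom X) := by
  have := hX.compactSpace
  have := nonempty_kHom hX
  have := (inIScP_hom (KHom X SignType)).t2Space
  obtain ⟨I, f, -, hf⟩ := hX
  let π : I → KHom X SignType := fun i =>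
    { toFun := fun x => f x i
      continuous' := (continuous_apply i).comp hf.isClosedEmbedding.continuous
      map_le' := fun x y h => (hf.le_iff x y).2 h i
      map_Q' := fun x y h => (hf.Q_iff x y).2 h i
      map_D' := fun x h => (hf.D_iff x).2 h i
      map_pt' := congrFun hf.map_pt i }
  refine ⟨(evalHom X).continuous'.isClosedEmbedding fun x y h => ?_, fun x y => ?_, fun x y => ?_,
    fun x => ?_, (evalHom X).map_pt'⟩
  · exact hf.isClosedEmbedding.injective (funext fun i => DFunLike.congr_fun h (π i))
  · exact ⟨fun h => (hf.le_iff x y).1 fun i => h (π i), (evalHom X).map_le' x y⟩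
  · exact ⟨fun h => (hf.Q_iff x y).1 fun i => h (π i), (evalHom X).map_Q' x y⟩
  · exact ⟨fun h => (hf.D_iff x).1 fun i => h (π i), (evalHom X).map_D' x⟩

theorem isKEmbedding_id : IsKEmbedding (fun x : X => x) :=
  ⟨.id, fun _ _ => .rfl, fun _ _ => .rfl, fun _ => .rfl, rfl⟩

theorem IsKEmbedding.comp {Y : Type v} {Z : Type w} [TopologicalSpace Y] [KStruct Y]
    [TopologicalSpace Z] [KStruct Z] {g : Y → Z} {f : X → Y} (hg : IsKEmbedding g)
    (hf : IsKEmbedding f) : IsKEmbedding fun x => g (f x) :=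
  ⟨hg.isClosedEmbedding.comp hf.isClosedEmbedding,
    fun x y => (hg.le_iff _ _).trans (hf.le_iff x y),
    fun x y => (hg.Q_iff _ _).trans (hf.Q_iff x y),
    fun x => (hg.D_iff _).trans (hf.D_iff x), (congrArg g hf.map_pt).trans hg.map_pt⟩

/-- A morphism followed by an embedding is an embedding only if the morphism is one. -/
theorem KHom.isKEmbedding_of_comp {Y : Type v} {Z : Type w} [TopologicalSpace Y] [KStruct Y]
    [TopologicalSpace Z] [KStruct Z] [CompactSpace X] [T2Space Y] (g : KHom Y Z) (f : KHom X Y)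
    (h : IsKEmbedding fun x => g (f x)) : IsKEmbedding f :=
  ⟨f.continuous'.isClosedEmbedding fun _ _ hxy => h.isClosedEmbedding.injective (congrArg g hxy),
    fun x y => ⟨fun hxy => (h.le_iff x y).1 (g.map_le' _ _ hxy), f.map_le' x y⟩,
    fun x y => ⟨fun hxy => (h.Q_iff x y).1 (g.map_Q' _ _ hxy), f.map_Q' x y⟩,
    fun x => ⟨fun hx => (h.D_iff x).1 (g.map_D' _ hx), f.map_D' x⟩, f.map_pt'⟩

/-! ### Two representation theorems -/

variable {B : Type v} [ILattice B]

/-- If `X` embeds in `D(B)`, then every morphism from `X` to the alter ego is the evaluation at an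
element of `B`. -/
theorem IsKEmbedding.exists_eval_eq [CompactSpace X] [Nonempty B]
    {c : X → ILatticeHom B SignType} (hc : IsKEmbedding c) (α : KHom X SignType) :
    ∃ b, ∀ x, c x b = α x := by
  have hcont : ∀ b, Continuous fun x => c x b := fun b =>
    (continuous_hom_apply b).comp hc.isClosedEmbedding.continuous
  have hpt : ∀ x, c x = KStruct.pt → α x = 0 := fun x h => by
    rw [hc.isClosedEmbedding.injective (h.trans hc.map_pt.symm)]
    exact α.map_pt'
  have two : ∀ x y, ∃ b, c x b = α x ∧ c y b = α y := fun x y =>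
    exists_hom_apply_eq_and_eq (c x) (c y) (α x) (α y) (hpt x) (hpt y)
      (fun h => α.map_D' x ((hc.D_iff x).1 h)) (fun h => α.map_D' y ((hc.D_iff y).1 h))
      (fun h => α.map_le' x y ((hc.le_iff x y).1 h))
      (fun h => α.map_le' y x ((hc.le_iff y x).1 h))
      (fun h => α.map_Q' x y ((hc.Q_iff x y).1 h))
  have nhds : ∀ b y, c y b = α y → ∀ᶠ z in nhds y, c z b = α z := fun b y h =>
    (isOpen_discrete {p : SignType × SignType | p.1 = p.2}).preimage
      ((hcont b).prodMk α.continuous') |>.mem_nhds h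
  -- Two-point interpolants agree with `α` at `x` and near `y`. Joining finitely many of them keeps
  -- the value at `x` and dominates `α` everywhere.
  have upper : ∀ x, ∃ b, c x b = α x ∧ ∀ y, α y ≤ c y b := by
    intro x
    suffices ∃ b, c x b = α x ∧ ∀ y ∈ Set.univ, α y ≤ c y b by simpa using this
    refine isCompact_univ.induction_on
      (p := fun S => ∃ b, c x b = α x ∧ ∀ y ∈ S, α y ≤ c y b) ?_ ?_ ?_ ?_
    · exact (two x x).imp fun b hb => ⟨hb.1, fun y hy => hy.elim⟩
    · exact fun s t hst ht => ht.imp fun b hb => ⟨hb.1, fun y hy => hb.2 y (hst hy)⟩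
    · rintro s t ⟨a, ha, ha'⟩ ⟨b, hb, hb'⟩
      refine ⟨a ⊔ b, by rw [ILatticeHom.map_sup, ha, hb, sup_idem], fun y hy => ?_⟩
      rw [ILatticeHom.map_sup]
      exact hy.elim (fun h => (ha' y h).trans le_sup_left) fun h => (hb' y h).trans le_sup_right
    · intro y _
      obtain ⟨b, hb, hb'⟩ := two x y
      exact ⟨_, mem_nhdsWithin_of_mem_nhds (nhds b y hb'), b, hb, fun z hz => ge_of_eq hz⟩
  -- Dually, a meet of upper interpolants still dominates `α`, and equals it wherever one of them
  -- does.
  suffices ∃ b, (∀ y, α y ≤ c y b) ∧ ∀ y ∈ Set.univ, c y b = α y by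
    obtain ⟨b, -, hb⟩ := this
    exact ⟨b, fun x => hb x trivial⟩
  refine isCompact_univ.induction_on
    (p := fun S => ∃ b, (∀ y, α y ≤ c y b) ∧ ∀ y ∈ S, c y b = α y) ?_ ?_ ?_ ?_
  · exact (upper KStruct.pt).imp fun b hb => ⟨hb.2, fun y hy => hy.elim⟩
  · exact fun s t hst ht => ht.imp fun b hb => ⟨hb.1, fun y hy => hb.2 y (hst hy)⟩
  · rintro s t ⟨a, ha, ha'⟩ ⟨b, hb, hb'⟩
    refine ⟨a ⊓ b, fun y => ?_, fun y hy => ?_⟩ <;> rw [ILatticeHom.map_inf]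
    · exact le_inf (ha y) (hb y)
    · rcases hy with h | h
      · rw [ha' y h, inf_eq_left]
        exact hb y
      · rw [hb' y h, inf_eq_right]
        exact ha y
  · intro y _
    obtain ⟨b, hb, hb'⟩ := upper y
    exact ⟨_, mem_nhdsWithin_of_mem_nhds (nhds b y hb), b, hb', fun z hz => hz⟩

/-- If the points of a compact structure `X`, acting by evaluations, separate the elements of `B`,
then every homomorphism from `B` to the three-element i-lattice is the evaluation at a point. -/
theorem KHom.surjective_of_separates [CompactSpace X] (c : KHom X (ILatticeHom B SignType))
    (hsep : ∀ a b : B, (∀ x, c x a = c x b) → a = b) : Function.Surjective c := by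
  intro u
  -- The constant homomorphism has empty preimage of `1`, so the filter argument below cannot start
  -- there.
  by_cases hu : u = KStruct.pt
  · exact ⟨KStruct.pt, c.map_pt'.trans hu.symm⟩
  obtain ⟨a₀, ha₀⟩ : ∃ a, u a = 1 := by
    have : ∃ a, u a ≠ 0 := by
      by_contra! h
      exact hu (ILatticeHom.ext h)
    obtain ⟨a, ha⟩ := this
    rcases (by decide : ∀ x : SignType, x ≠ 0 → x = 1 ∨ -x = 1) _ ha with h | h
    · exact ⟨a, h⟩
    · exact ⟨-a, (u.map_neg a).trans h⟩
  have hb₀ : u (-a₀) ≠ 1 := by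
    rw [u.map_neg, ha₀]
    decide
  have hcont : ∀ b, Continuous fun x => c x b := fun b =>
    (continuous_hom_apply b).comp c.continuous'
  let ι := {a : B // u a = 1} × {b : B // u b ≠ 1}
  have : Nonempty ι := ⟨⟨a₀, ha₀⟩, ⟨-a₀, hb₀⟩⟩
  let t : ι → Set X := fun i => {x | c x i.1 = 1 ∧ c x i.2 ≠ 1}
  have htcl : ∀ i, IsClosed (t i) := fun i =>
    ((isClosed_discrete {(1 : SignType)}).preimage (hcont i.1)).inter
      ((isClosed_discrete {(1 : SignType)}ᶜ).preimage (hcont i.2))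
  have htn : ∀ i, (t i).Nonempty := by
    rintro ⟨⟨a, ha⟩, b, hb⟩
    by_contra h
    have h' : ∀ x, c x a = 1 → c x b = 1 := fun x hx => by
      by_contra hx'
      exact h ⟨x, hx, hx'⟩
    -- The implication concerns only the value `1`; the term `a ⊓ -a` absorbs the points where `a`
    -- is `0` or `-1`, giving an inequality in `B`. Under `u` that term becomes `-1`, which forces
    -- `u b = 1`.
    have hab : a ⊔ (b ⊔ (a ⊓ -a)) = b ⊔ (a ⊓ -a) := hsep _ _ fun x => by
      simp only [ILatticeHom.map_sup, ILatticeHom.map_inf, ILatticeHom.map_neg]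
      exact (by decide : ∀ p q : SignType, (p = 1 → q = 1) → p ⊔ (q ⊔ (p ⊓ -p)) = q ⊔ (p ⊓ -p))
        _ _ (h' x)
    have := congrArg u hab
    simp only [ILatticeHom.map_sup, ILatticeHom.map_inf, ILatticeHom.map_neg, ha] at this
    exact (by decide : ∀ q : SignType, q ≠ 1 → 1 ⊔ (q ⊔ (1 ⊓ -1)) ≠ q ⊔ (1 ⊓ -1)) _ hb this
  have htd : Directed (· ⊇ ·) t := by
    rintro ⟨⟨a, ha⟩, b, hb⟩ ⟨⟨a', ha'⟩, b', hb'⟩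
    refine ⟨⟨⟨a ⊓ a', by rw [u.map_inf, ha, ha', inf_idem]⟩, b ⊔ b', ?_⟩, ?_, ?_⟩
    · rw [u.map_sup]
      exact (by decide : ∀ p q : SignType, p ≠ 1 → q ≠ 1 → p ⊔ q ≠ 1) _ _ hb hb'
    all_goals
      rintro x ⟨hx, hx'⟩
      simp only [ILatticeHom.map_sup, ILatticeHom.map_inf] at hx hx'
      have := (by decide : ∀ p q r s : SignType, p ⊓ q = 1 → r ⊔ s ≠ 1 →
        (p = 1 ∧ r ≠ 1) ∧ q = 1 ∧ s ≠ 1) _ _ _ _ hx hx'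
    exacts [this.1, this.2]
  obtain ⟨x, hx⟩ := IsCompact.nonempty_iInter_of_directed_nonempty_isCompact_isClosed t htd htn
    (fun i => (htcl i).isCompact) htcl
  rw [Set.mem_iInter] at hx
  -- `a₀` and `-a₀` merely fill the other component of the index.
  have key : ∀ a, c x a = 1 ↔ u a = 1 := fun a => by
    by_cases ha : u a = 1
    · exact iff_of_true (hx ⟨⟨a, ha⟩, -a₀, hb₀⟩).1 ha
    · exact iff_of_false (hx ⟨⟨a₀, ha₀⟩, a, ha⟩).2 ha
  refine ⟨x, ILatticeHom.ext fun a => ?_⟩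
  have h1 := key a
  have h2 := key (-a)
  rw [ILatticeHom.map_neg, ILatticeHom.map_neg] at h2
  exact (by decide : ∀ p q : SignType, (p = 1 ↔ q = 1) → (-p = 1 ↔ -q = 1) → p = q) _ _ h1 h2

end Topology

/-! ### Isomorphisms in the two categories -/

theorem NormalILat.isIso_of_bijective {A B : NormalILat.{u}} (h : A ⟶ B)
    (hh : Function.Bijective (toMap h)) : IsIso h := by
  obtain ⟨g, hgl, hgr⟩ := Function.bijective_iff_has_inverse.1 hh
  let h' : ILatticeHom A B := h
  let k : ILatticeHom B A :=
    { toFun := g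
      map_sup' := fun a b => hh.1 <| by
        rw [hgr]
        exact ((h'.map_sup _ _).trans (congrArg₂ (· ⊔ ·) (hgr a) (hgr b))).symm
      map_inf' := fun a b => hh.1 <| by
        rw [hgr]
        exact ((h'.map_inf _ _).trans (congrArg₂ (· ⊓ ·) (hgr a) (hgr b))).symm
      map_neg' := fun a => hh.1 <| by
        rw [hgr]
        exact ((h'.map_neg _).trans (congrArg (- ·) (hgr a))).symm }
  exact ⟨k, ILatticeHom.ext hgl, ILatticeHom.ext hgr⟩

theorem PKleeneSp.isIso_of_isKEmbedding {X Y : PKleeneSp.{u}} (φ : X ⟶ Y)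
    (hφ : IsKEmbedding (toMap φ)) (hs : Function.Surjective (toMap φ)) : IsIso φ := by
  let e : X ≃ₜ Y := (Equiv.ofBijective _ ⟨hφ.isClosedEmbedding.injective, hs⟩).toHomeomorphOfIsInducing
    hφ.isClosedEmbedding.isInducing
  have he : ∀ y, toMap φ (e.symm y) = y := e.apply_symm_apply
  let k : KHom Y X :=
    { toFun := e.symm
      continuous' := e.symm.continuous
      map_le' := fun x y h => (hφ.le_iff _ _).1 (by rwa [he, he])
      map_Q' := fun x y h => (hφ.Q_iff _ _).1 (by rwa [he, he])
      map_D' := fun x h => (hφ.D_iff _).1 (by rwa [he])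
      map_pt' := hφ.isClosedEmbedding.injective ((he _).trans hφ.map_pt.symm) }
  exact ⟨k, KHom.ext e.symm_apply_apply, KHom.ext he⟩

/-! ### Duality, fullness and strongness -/

instance NormalILat.compactSpace_hom (A : NormalILat.{u}) :
    CompactSpace (ILatticeHom A SignType) := (inIScP_hom A).compactSpace

instance NormalILat.t2Space_hom (A : NormalILat.{u}) : T2Space (ILatticeHom A SignType) :=
  (inIScP_hom A).t2Space

instance PKleeneSp.compactSpace (X : PKleeneSp.{u}) : CompactSpace X := X.mem.compactSpace

instance PKleeneSp.t2Space (X : PKleeneSp.{u}) : T2Space X := X.mem.t2Space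

instance PKleeneSp.nonempty_kHom (X : PKleeneSp.{u}) : Nonempty (KHom X SignType) :=
  _root_.nonempty_kHom X.mem

theorem bijective_evalE (A : NormalILat.{u}) :
    Function.Bijective (NormalILat.toMap (evalE.app A)) := by
  refine ⟨fun a b h => ILattice.eq_of_forall_hom_eq fun f => ?_, fun α => ?_⟩
  · exact congrArg (fun β : KHom (ILatticeHom A SignType) SignType => β f) h
  · obtain ⟨a, ha⟩ := isKEmbedding_id.exists_eval_eq α
    exact ⟨a, KHom.ext ha⟩

theorem surjective_evalHom (X : PKleeneSp.{u}) : Function.Surjective (evalHom X) :=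
  (evalHom X).surjective_of_separates fun _ _ h => KHom.ext h

section Algebras

variable {A B : NormalILat.{u}} (h : A ⟶ B)

theorem isKEmbedding_dualD_map (hh : Function.Surjective (NormalILat.toMap h)) :
    IsKEmbedding (PKleeneSp.toMap (dualD.map h.op)) := by
  let φ : KHom (ILatticeHom B SignType) (ILatticeHom A SignType) := dualD.map h.op
  refine ⟨φ.continuous'.isClosedEmbedding fun x y hxy => ILatticeHom.ext fun b => ?_,
    fun x y => ⟨fun hxy b => ?_, φ.map_le' x y⟩, fun x y => ⟨fun hxy b => ?_, φ.map_Q' x y⟩,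
    fun x => ⟨fun hx b => ?_, φ.map_D' x⟩, rfl⟩ <;> obtain ⟨a, rfl⟩ := hh b
  · exact DFunLike.congr_fun hxy a
  · exact hxy a
  · exact hxy a
  · exact hx a

/-- Evaluation at `b` is a morphism on `D(B)`; as `D(B)` embeds in `D(A)`, it is also evaluation at
some `a`, and separation gives `h a = b`. -/
theorem surjective_of_isKEmbedding_dualD_map
    (hh : IsKEmbedding (PKleeneSp.toMap (dualD.map h.op))) :
    Function.Surjective (NormalILat.toMap h) := by
  intro b
  let α : KHom (ILatticeHom B SignType) SignType := NormalILat.toMap (evalE.app B) b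
  let φ : KHom (ILatticeHom B SignType) (ILatticeHom A SignType) := dualD.map h.op
  have hφ : IsKEmbedding φ := hh
  obtain ⟨a, ha⟩ := hφ.exists_eval_eq α
  exact ⟨a, ILattice.eq_of_forall_hom_eq ha⟩

/-- Injectivity of `h` means that the homomorphisms factoring through `h` separate `A`. -/
theorem surjective_dualD_map (hh : Function.Injective (NormalILat.toMap h)) :
    Function.Surjective (PKleeneSp.toMap (dualD.map h.op)) := by
  let φ : KHom (ILatticeHom B SignType) (ILatticeHom A SignType) := dualD.map h.op
  exact φ.surjective_of_separates fun _ _ hab => hh (ILattice.eq_of_forall_hom_eq hab)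

theorem injective_of_surjective_dualD_map
    (hh : Function.Surjective (PKleeneSp.toMap (dualD.map h.op))) :
    Function.Injective (NormalILat.toMap h) := by
  refine fun a b hab => ILattice.eq_of_forall_hom_eq fun f => ?_
  obtain ⟨g, rfl⟩ := hh f
  let g' : ILatticeHom B SignType := g
  exact congrArg g' hab

end Algebras

section Spaces

variable {X Y : PKleeneSp.{u}} (φ : X ⟶ Y)

theorem surjective_dualE_map (hφ : IsKEmbedding (PKleeneSp.toMap φ)) :
    Function.Surjective (NormalILat.toMap (dualE.map φ.op)) := by
  intro α
  obtain ⟨β, hβ⟩ := ((isKEmbedding_evalHom Y.mem).comp hφ).exists_eval_eq α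
  exact ⟨β, KHom.ext hβ⟩

theorem isKEmbedding_of_surjective_dualE_map
    (h : Function.Surjective (NormalILat.toMap (dualE.map φ.op))) :
    IsKEmbedding (PKleeneSp.toMap φ) := by
  -- By naturality, which holds definitionally, this composite `DE(φ) ∘ ε_X` is `ε_Y ∘ φ`.
  have key := (isKEmbedding_dualD_map _ h).comp (isKEmbedding_evalHom X.mem)
  exact KHom.isKEmbedding_of_comp (evalHom Y) φ key

theorem injective_dualE_map (hφ : Function.Surjective (PKleeneSp.toMap φ)) :
    Function.Injective (NormalILat.toMap (dualE.map φ.op)) := by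
  refine fun α β hαβ => KHom.ext fun y => ?_
  obtain ⟨x, rfl⟩ := hφ y
  exact congrArg (fun γ : KHom X SignType => γ x) hαβ

theorem surjective_of_injective_dualE_map
    (h : Function.Injective (NormalILat.toMap (dualE.map φ.op))) :
    Function.Surjective (PKleeneSp.toMap φ) := by
  intro y
  -- Lift `ε_Y(y)` along `DE(φ)`, then along `ε_X`; naturality gives `ε_Y(φ x) = ε_Y(y)`.
  obtain ⟨u, hu⟩ := surjective_dualD_map _ h (evalHom Y y)
  obtain ⟨x, rfl⟩ := surjective_evalHom X u
  exact ⟨x, (isKEmbedding_evalHom Y.mem).isClosedEmbedding.injective hu⟩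

end Spaces

/-- The class of normal i-lattices is the prevariety generated by the three-element one; the dual
adjunction is a natural duality; it is full; and it is strong, i.e. it exchanges embeddings and
surjections. -/
theorem mainTheorem6 :
    (∀ (A : Type u) [ILattice A] [Nonempty A], IsNormalILattice A ↔ InISP A) ∧
    (∀ A : NormalILat.{u}, IsIso (evalE.app A)) ∧
    (∀ X : PKleeneSp.{u}, IsIso (evalD.app X)) ∧
    (∀ (A B : NormalILat.{u}) (h : A ⟶ B),
      (Function.Surjective (NormalILat.toMap h) ↔
        IsKEmbedding (PKleeneSp.toMap (dualD.map h.op))) ∧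
      (Function.Injective (NormalILat.toMap h) ↔
        Function.Surjective (PKleeneSp.toMap (dualD.map h.op)))) ∧
    (∀ (X Y : PKleeneSp.{u}) (φ : X ⟶ Y),
      (IsKEmbedding (PKleeneSp.toMap φ) ↔
        Function.Surjective (NormalILat.toMap (dualE.map φ.op))) ∧
      (Function.Surjective (PKleeneSp.toMap φ) ↔
        Function.Injective (NormalILat.toMap (dualE.map φ.op)))) := by
  refine ⟨fun A _ _ => isNormalILattice_iff_inISP A,
    fun A => NormalILat.isIso_of_bijective _ (bijective_evalE A),
    fun X => PKleeneSp.isIso_of_isKEmbedding _ (isKEmbedding_evalHom X.mem)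
      (surjective_evalHom X),
    fun A B h => ⟨⟨isKEmbedding_dualD_map h, surjective_of_isKEmbedding_dualD_map h⟩,
      ⟨surjective_dualD_map h, injective_of_surjective_dualD_map h⟩⟩,
    fun X Y φ => ⟨⟨surjective_dualE_map φ, isKEmbedding_of_surjective_dualE_map φ⟩,
      ⟨injective_dualE_map φ, surjective_of_injective_dualE_map φ⟩⟩⟩
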